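/- Let $\mathcal H$ be a finite-dimensional complex Hilbert space and let $X$ be a random variable with values in a set $\mathcal X$. For each $x\in\mathcal X$ let $\rho_x$ be a quantum state on $\mathcal H$ (a positive semidefinite operator of trace one), depending measurably on $x$, and let $\rho=\mathbb E_X[\rho_X]$. For Hermitian operators $A,B$ write $\{A\succeq B\}$ (respectively $\{A\succ B\}$) for the orthogonal projector onto the span of the eigenvectors of $A-B$ with nonnegative (respectively positive) eigenvalue. For $i=1,2,\dots$ let $\Pi_i$ be the orthogonal projector onto the span of the eigenvectors of $\rho$ whose eigenvalue $\lambda$ satisfies $2^{-(i-1)}\ge\lambda>2^{-i}$. Fix two distinct indices $i\ne l$ and a real number $I>0$, and for each $x\in\mathcal X$ define $$\Pi_x=\{2^I\rho\succeq\rho_x\},\qquad \rho'_x=\Pi_x\rho_x\Pi_x,\qquad \Pi^-_{k,x}=\Pi_k-\{\Pi_k\Pi_x\rho\Pi_x\Pi_k\succ 4\,\Pi_k\rho\Pi_k\}\quad(k\in\{i,l\}),$$ $$\sigma^-_{i,l,x}=\Pi^-_{i,x}\,\rho'_x\,\Pi^-_{l,x}.$$ Let $X[1],\dots,X[M]$ be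 independent samples drawn according to the distribution of $X$, let $\tilde\sigma^-_{i,l}=\frac1M\sum_{m=1}^M\sigma^-_{i,l,X[m]}$ and $\sigma^-_{i,l}=\mathbb E_X[\sigma^-_{i,l,X}]$. Then, for every $0<\varepsilon<1$, $$\Pr\left\{\|\tilde\sigma^-_{i,l}-\sigma^-_{i,l}\|\ge\varepsilon\right\}\le 25\,\dim(\mathcal H)\,\exp\left(-10^{-12}\,\varepsilon^3\,\frac{M}{2^I}\right),$$ where $\|\cdot\|$ is the trace norm (the sum of the singular values). -/

import Mathlib

open MeasureTheory ProbabilityTheory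
open scoped ComplexOrder Matrix

noncomputable section

namespace QuantumCovering

/-- A quantum state (density matrix) on the Hilbert space `ℂ^n`: a positive semidefinite
matrix of trace one. -/
structure IsState {n : Type*} [Fintype n] (ρ : Matrix n n ℂ) : Prop where
  posSemidef : ρ.PosSemidef
  trace_eq_one : ρ.trace = 1

/-- For a Hermitian matrix `A`, the orthogonal projector onto the span of the eigenvectors of `A`
whose eigenvalue lies in `s`. -/
def spectralProj {n : Type*} [Fintype n] [DecidableEq n] (s : Set ℝ) (A : Matrix n n ℂ) :
    Matrix n n ℂ :=
  cfc (s.indicator (fun _ : ℝ => (1 : ℝ))) A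

/-- The projector `{A ⪰ B}` onto the span of the eigenvectors of `A - B` with nonnegative
eigenvalue. -/
def projGE {n : Type*} [Fintype n] [DecidableEq n] (A B : Matrix n n ℂ) : Matrix n n ℂ :=
  spectralProj (Set.Ici 0) (A - B)

/-- The projector `{A ≻ B}` onto the span of the eigenvectors of `A - B` with positive
eigenvalue. -/
def projGT {n : Type*} [Fintype n] [DecidableEq n] (A B : Matrix n n ℂ) : Matrix n n ℂ :=
  spectralProj (Set.Ioi 0) (A - B)

/-- The trace norm: the sum of the singular values of `A`, i.e. of the square roots of the
eigenvalues of `Aᴴ * A`. -/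
def traceNorm {n : Type*} [Fintype n] [DecidableEq n] (A : Matrix n n ℂ) : ℝ :=
  ∑ j, √((Matrix.isHermitian_conjTranspose_mul_self A).eigenvalues j)

/-- The expectation of a random matrix `A x`, with `x` distributed according to `μ`. -/
def expect {n 𝒳 : Type*} [MeasurableSpace 𝒳] (μ : Measure 𝒳) (A : 𝒳 → Matrix n n ℂ) :
    Matrix n n ℂ :=
  Matrix.of fun a b => ∫ x, A x a b ∂μ

/-- The average of `M` matrices. -/
def sampleMean {n : Type*} {M : ℕ} (A : Fin M → Matrix n n ℂ) : Matrix n n ℂ :=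
  (M : ℝ)⁻¹ • ∑ m, A m

/-- The projector `Π_i` onto the span of the eigenvectors of `ρ` whose eigenvalue `t` satisfies
`2^(-i) < t ≤ 2^(-(i-1))`. -/
def bandProj {n : Type*} [Fintype n] [DecidableEq n] (ρ : Matrix n n ℂ) (i : ℕ) :
    Matrix n n ℂ :=
  spectralProj (Set.Ioc ((2 : ℝ) ^ (-(i : ℤ))) ((2 : ℝ) ^ (-((i : ℤ) - 1)))) ρ

/-- The projector `Π_x = {2^I ρ ⪰ ρ_x}`; the argument `ρx` is the state `ρ_x`. -/
def cutProj {n : Type*} [Fintype n] [DecidableEq n] (I : ℝ) (ρ ρx : Matrix n n ℂ) :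
    Matrix n n ℂ :=
  projGE ((2 : ℝ) ^ I • ρ) ρx

/-- The operator `ρ'_x = Π_x ρ_x Π_x`. -/
def cutState {n : Type*} [Fintype n] [DecidableEq n] (I : ℝ) (ρ ρx : Matrix n n ℂ) :
    Matrix n n ℂ :=
  cutProj I ρ ρx * ρx * cutProj I ρ ρx

/-- The projector `Π⁻_{i,x} = {Π_i Π_x ρ Π_x Π_i ⪯ 4 Π_i ρ Π_i}` inside the range of `Π_i`, that
is, `Π_i - {Π_i Π_x ρ Π_x Π_i ≻ 4 Π_i ρ Π_i}`. Both matrices that are compared vanish on the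
orthogonal complement of the range of `Π_i`, so the subtracted projector lies below `Π_i`. -/
def bandMinus {n : Type*} [Fintype n] [DecidableEq n] (I : ℝ) (ρ ρx : Matrix n n ℂ) (i : ℕ) :
    Matrix n n ℂ :=
  bandProj ρ i -
    projGT (bandProj ρ i * cutProj I ρ ρx * ρ * cutProj I ρ ρx * bandProj ρ i)
      ((4 : ℝ) • (bandProj ρ i * ρ * bandProj ρ i))

/-- The off-diagonal block `σ⁻_{i,l,x} = Π⁻_{i,x} ρ'_x Π⁻_{l,x}`. -/
def offDiagBlock {n : Type*} [Fintype n] [DecidableEq n] (I : ℝ) (ρ : Matrix n n ℂ) (i l : ℕ)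
    (ρx : Matrix n n ℂ) : Matrix n n ℂ :=
  bandMinus I ρ ρx i * cutState I ρ ρx * bandMinus I ρ ρx l

end QuantumCovering

end

/-! A low-rank matrix with small Frobenius norm has small trace norm, and independent Hilbert-space
vectors concentrate at a rate independent of the dimension.

The block `P R Q`, with `R` the cut state, satisfies `Q R Q ≤ 8 · 2^I · 2^(-l)`
(`bandMinus_conj_cutState_le`). Since `R` has trace at most one, its squared Frobenius norm is at
most this bound (`trace_conj_mul_le`). Passing to the adjoint gives the same with `i`, so `2^(-max i
l)` is available. The average minus the mean stays between the two bands, so its rank is at most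
`2^(min i l)`, because a state has at most `2^l` eigenvalues above `2^(-l)`. By Cauchy–Schwarz the
squared trace norm is at most rank times squared Frobenius norm (`traceNorm_sq_le`). The powers of
two cancel, leaving the scale `8 · 2^I` for any pair of bands.

Concentration comes from Hoeffding's lemma applied one summand at a time to 1-Lipschitz functions, a
class preserved by averaging over a summand. Applied to the norm, whose mean is controlled by
orthogonality of centred independent vectors, it gives `exp(-ε² M / (128 · 2^I))` once `ε² M > 512 ·
2^I`. For smaller `M` the claimed bound exceeds one. -/

/-! ### Lipschitz functions of bounded random vectors and convolutions -/

section Concentration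

set_option linter.unusedSectionVars false

variable {E : Type*} [NormedAddCommGroup E] [MeasurableSpace E] [BorelSpace E]
  [SecondCountableTopology E]

/-- A continuous function that is bounded on bounded sets is integrable for a finite measure that is
concentrated on a ball. -/
theorem integrable_of_ae_norm_le {F : Type*} [NormedAddCommGroup F] {κ : Measure E}
    [IsFiniteMeasure κ] {R K : ℝ} (hκ : ∀ᵐ x ∂κ, ‖x‖ ≤ R) {f : E → F} (hf : Continuous f)
    [SecondCountableTopologyEither E F] (hK : ∀ x, ‖x‖ ≤ R → ‖f x‖ ≤ K) : Integrable f κ :=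
  Integrable.of_bound hf.aestronglyMeasurable K (hκ.mono hK)

theorem LipschitzWith.abs_le_of_norm_le {g : E → ℝ} (hg : LipschitzWith 1 g) {R : ℝ} {x : E}
    (hx : ‖x‖ ≤ R) : |g x| ≤ |g 0| + R := by
  have h := hg.dist_le_mul x 0
  rw [Real.dist_eq, dist_zero_right] at h
  have h2 := abs_sub_abs_le_abs_sub (g x) (g 0)
  simp at h
  linarith

theorem LipschitzWith.integrable_of_ae_norm_le {g : E → ℝ} (hg : LipschitzWith 1 g) {R : ℝ}
    {κ : Measure E} [IsFiniteMeasure κ] (hκ : ∀ᵐ x ∂κ, ‖x‖ ≤ R) : Integrable g κ :=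
  _root_.integrable_of_ae_norm_le hκ hg.continuous fun _ hx => hg.abs_le_of_norm_le hx

theorem LipschitzWith.integrable_exp_of_ae_norm_le {g : E → ℝ} (hg : LipschitzWith 1 g) {R : ℝ}
    {κ : Measure E} [IsFiniteMeasure κ] (hκ : ∀ᵐ x ∂κ, ‖x‖ ≤ R) (t : ℝ) :
    Integrable (fun x => Real.exp (t * g x)) κ := by
  refine _root_.integrable_of_ae_norm_le (K := Real.exp (|t| * (|g 0| + R))) hκ
    (by have := hg.continuous; fun_prop) fun x hx => ?_
  rw [Real.norm_eq_abs, Real.abs_exp, Real.exp_le_exp]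
  calc t * g x ≤ |t * g x| := le_abs_self _
    _ = |t| * |g x| := abs_mul _ _
    _ ≤ _ := by gcongr; exact hg.abs_le_of_norm_le hx

theorem LipschitzWith.comp_const_add {g : E → ℝ} (hg : LipschitzWith 1 g) (x : E) :
    LipschitzWith 1 fun y => g (x + y) := by
  refine LipschitzWith.of_dist_le_mul fun y z => ?_
  simpa using hg.dist_le_mul (x + y) (x + z)

/-- This closes the induction over summands: integrating one out leaves a function of the same
class. -/
theorem LipschitzWith.integral_add {g : E → ℝ} (hg : LipschitzWith 1 g) {ν : Measure E}
    [IsProbabilityMeasure ν] {c : ℝ} (hν : ∀ᵐ y ∂ν, ‖y‖ ≤ c) :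
    LipschitzWith 1 fun x => ∫ y, g (x + y) ∂ν := by
  refine LipschitzWith.of_dist_le_mul fun x z => ?_
  rw [Real.dist_eq, ← integral_sub ((hg.comp_const_add x).integrable_of_ae_norm_le hν)
    ((hg.comp_const_add z).integrable_of_ae_norm_le hν)]
  have := norm_integral_le_of_norm_le_const (μ := ν) (C := dist x z)
    (f := fun y => g (x + y) - g (z + y)) (Filter.Eventually.of_forall fun y => by
      simpa [Real.dist_eq] using hg.dist_le_mul (x + y) (z + y))
  simpa using this

/-- Hoeffding's lemma for a Lipschitz function of a bounded random vector. -/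
theorem LipschitzWith.integral_exp_le {g : E → ℝ} (hg : LipschitzWith 1 g) {ν : Measure E}
    [IsProbabilityMeasure ν] {c : ℝ} (hc : 0 ≤ c) (hν : ∀ᵐ y ∂ν, ‖y‖ ≤ c) (t : ℝ) :
    ∫ y, Real.exp (t * g y) ∂ν ≤ Real.exp (t * ∫ y, g y ∂ν) * Real.exp (t ^ 2 * c ^ 2 / 2) := by
  have hb : ∀ᵐ y ∂ν, g y ∈ Set.Icc (g 0 - c) (g 0 + c) := by
    filter_upwards [hν] with y hy
    have h := hg.dist_le_mul y 0
    rw [Real.dist_eq, dist_zero_right] at h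
    simp at h
    have := abs_le.1 (h.trans hy)
    constructor <;> linarith
  have h := (hasSubgaussianMGF_of_mem_Icc hg.continuous.aemeasurable hb).mgf_le t
  -- On the ball of radius `c` the function ranges over an interval of length `2c`, so Hoeffding's
  -- variance proxy is `c²`.
  have hw : (((‖(g 0 + c) - (g 0 - c)‖₊ / 2) ^ 2 : NNReal) : ℝ) = c ^ 2 := by
    have : ‖(g 0 + c) - (g 0 - c)‖ = 2 * c := by
      rw [Real.norm_eq_abs, abs_of_nonneg] <;> linarith
    push_cast
    rw [this]; ring
  rw [hw] at h
  have e : mgf (fun y => g y - ∫ y, g y ∂ν) ν t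
      = Real.exp (-(t * ∫ y, g y ∂ν)) * ∫ y, Real.exp (t * g y) ∂ν := by
    rw [mgf, ← integral_const_mul]
    congr 1; ext y; rw [← Real.exp_add]; ring_nf
  rw [e, Real.exp_neg, inv_mul_le_iff₀ (Real.exp_pos _)] at h
  refine h.trans (le_of_eq ?_)
  congr 2; ring

theorem ae_norm_le_conv {κ ν : Measure E} [IsProbabilityMeasure κ] [IsProbabilityMeasure ν]
    {R c : ℝ} (hκ : ∀ᵐ x ∂κ, ‖x‖ ≤ R) (hν : ∀ᵐ y ∂ν, ‖y‖ ≤ c) :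
    ∀ᵐ z ∂(κ ∗ ν), ‖z‖ ≤ R + c := by
  rw [Measure.conv, ae_map_iff (by fun_prop)
    (measurableSet_le measurable_norm measurable_const)]
  filter_upwards [Measure.quasiMeasurePreserving_fst.ae hκ,
    Measure.quasiMeasurePreserving_snd.ae hν] with p h1 h2
  exact (norm_add_le _ _).trans (add_le_add h1 h2)

/-- Subgaussian moment bound, for Lipschitz functions, of a convolution. -/
theorem LipschitzWith.integral_exp_conv_le {κ ν : Measure E} [IsProbabilityMeasure κ]
    [IsProbabilityMeasure ν] {R c V t : ℝ} (hc : 0 ≤ c) (hκ : ∀ᵐ x ∂κ, ‖x‖ ≤ R)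
    (hν : ∀ᵐ y ∂ν, ‖y‖ ≤ c)
    (ih : ∀ h : E → ℝ, LipschitzWith 1 h →
      ∫ x, Real.exp (t * h x) ∂κ ≤ Real.exp (t * ∫ x, h x ∂κ) * Real.exp V)
    {g : E → ℝ} (hg : LipschitzWith 1 g) :
    ∫ z, Real.exp (t * g z) ∂(κ ∗ ν) ≤
      Real.exp (t * ∫ z, g z ∂(κ ∗ ν)) * Real.exp (V + t ^ 2 * c ^ 2 / 2) := by
  have hκν := ae_norm_le_conv hκ hν
  rw [integral_conv (hg.integrable_exp_of_ae_norm_le hκν t),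
    integral_conv (hg.integrable_of_ae_norm_le hκν)]
  have hh := hg.integral_add hν
  -- Hoeffding's lemma in `y` for fixed `x`, then `ih` for the function averaged over `y`.
  calc ∫ x, ∫ y, Real.exp (t * g (x + y)) ∂ν ∂κ
      ≤ ∫ x, Real.exp (t * ∫ y, g (x + y) ∂ν) * Real.exp (t ^ 2 * c ^ 2 / 2) ∂κ := by
        refine integral_mono_of_nonneg (Filter.Eventually.of_forall fun x =>
          integral_nonneg fun y => (Real.exp_pos _).le) ?_
          (Filter.Eventually.of_forall fun x =>
            (hg.comp_const_add x).integral_exp_le hc hν t)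
        exact (hh.integrable_exp_of_ae_norm_le hκ t).mul_const _
    _ = (∫ x, Real.exp (t * ∫ y, g (x + y) ∂ν) ∂κ) * Real.exp (t ^ 2 * c ^ 2 / 2) :=
        integral_mul_const _ _
    _ ≤ (Real.exp (t * ∫ x, ∫ y, g (x + y) ∂ν ∂κ) * Real.exp V)
          * Real.exp (t ^ 2 * c ^ 2 / 2) := by
        gcongr; exact ih _ hh
    _ = _ := by rw [mul_assoc, ← Real.exp_add]

/-- Pythagoras: the cross term vanishes because `ν` is centred. -/
theorem integral_norm_sq_conv {𝕜 : Type*} [RCLike 𝕜] [InnerProductSpace 𝕜 E] [NormedSpace ℝ E]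
    [CompleteSpace E] {κ ν : Measure E} [IsProbabilityMeasure κ]
    [IsProbabilityMeasure ν] {R c : ℝ} (hκ : ∀ᵐ x ∂κ, ‖x‖ ≤ R)
    (hν : ∀ᵐ y ∂ν, ‖y‖ ≤ c) (h0 : ∫ y, y ∂ν = 0) :
    ∫ z, ‖z‖ ^ 2 ∂(κ ∗ ν) = ∫ x, ‖x‖ ^ 2 ∂κ + ∫ y, ‖y‖ ^ 2 ∂ν := by
  have hsq : ∀ {R : ℝ} {κ : Measure E} [IsProbabilityMeasure κ], (∀ᵐ x ∂κ, ‖x‖ ≤ R) →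
      Integrable (fun x => ‖x‖ ^ 2) κ := fun {R} κ _ h =>
    integrable_of_ae_norm_le (K := R ^ 2) h (by fun_prop) fun x hx => by
      rw [norm_pow, norm_norm]; gcongr
  have hid : Integrable (fun y : E => y) ν :=
    integrable_of_ae_norm_le hν continuous_id fun x hx => hx
  rw [integral_conv (hsq (ae_norm_le_conv hκ hν))]
  have : ∀ x, ∫ y, ‖x + y‖ ^ 2 ∂ν = ‖x‖ ^ 2 + ∫ y, ‖y‖ ^ 2 ∂ν := by
    intro x
    have hin : Integrable (fun y => RCLike.re (inner 𝕜 x y)) ν := (hid.const_inner x).re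
    simp_rw [norm_add_sq (𝕜 := 𝕜)]
    rw [integral_add (f := fun y => ‖x‖ ^ 2 + 2 * RCLike.re (inner 𝕜 x y))
        ((integrable_const _).add (hin.const_mul 2)) (hsq hν),
      integral_add (integrable_const _) (hin.const_mul 2), integral_const_mul,
      integral_re (hid.const_inner x), integral_inner hid, h0]
    simp
  simp_rw [this]
  rw [integral_add (hsq hκ) (integrable_const _)]
  simp

end Concentration

/-! ### Tail bound for the norm of an independent sum -/

section IndependentSums

variable {E : Type*} [NormedAddCommGroup E] [MeasurableSpace E] [BorelSpace E]
  [SecondCountableTopology E]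

/-- Concentration of the norm of a sum of independent, centred and bounded random vectors in a
Hilbert space. -/
theorem ProbabilityTheory.iIndepFun.measureReal_le_norm_sum_le (𝕜 : Type*) [RCLike 𝕜]
    [InnerProductSpace 𝕜 E] [NormedSpace ℝ E] [CompleteSpace E] {Ω ι : Type*} [MeasurableSpace Ω]
    [Fintype ι] {P : Measure Ω} [IsProbabilityMeasure P] {Y : ι → Ω → E} (hY : iIndepFun Y P)
    (hm : ∀ i, AEMeasurable (Y i) P) {c : ℝ} (hc : 0 ≤ c) (hb : ∀ i, ∀ᵐ ω ∂P, ‖Y i ω‖ ≤ c)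
    (h0 : ∀ i, ∫ ω, Y i ω ∂P = 0) (r : ℝ) {t : ℝ} (ht : 0 ≤ t) :
    P.real {ω | r ≤ ‖∑ i, Y i ω‖} ≤
      Real.exp (-(t * r) + t * (√(Fintype.card ι) * c) + Fintype.card ι * (t ^ 2 * c ^ 2 / 2)) := by
  classical
  -- The ball provides integrability; the exponential bound must hold for all 1-Lipschitz `g`, since
  -- adding a summand replaces `g` by an average of its translates; the second moment will bound the
  -- mean of the norm.
  have key : ∀ s : Finset ι,
      (∃ R, ∀ᵐ x ∂(P.map (∑ i ∈ s, Y i)), ‖x‖ ≤ R) ∧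
      (∀ g : E → ℝ, LipschitzWith 1 g → ∫ x, Real.exp (t * g x) ∂(P.map (∑ i ∈ s, Y i)) ≤
        Real.exp (t * ∫ x, g x ∂(P.map (∑ i ∈ s, Y i)))
          * Real.exp (s.card * (t ^ 2 * c ^ 2 / 2))) ∧
      ∫ x, ‖x‖ ^ 2 ∂(P.map (∑ i ∈ s, Y i)) ≤ s.card * c ^ 2 := by
    intro s
    induction s using Finset.induction_on with
    | empty =>
      have : P.map (∑ i ∈ (∅ : Finset ι), Y i) = Measure.dirac 0 := by
        rw [Finset.sum_empty]
        exact (Measure.map_const P (0 : E)).trans (by simp)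
      rw [this]
      exact ⟨⟨0, by simp⟩, fun g _ => by simp, by simp⟩
    | insert a s ha ih =>
      obtain ⟨⟨R, hR⟩, hexp, hsq⟩ := ih
      have hsm : AEMeasurable (∑ i ∈ s, Y i) P := Finset.aemeasurable_sum s fun i _ => hm i
      have : IsProbabilityMeasure (P.map (∑ i ∈ s, Y i)) := Measure.isProbabilityMeasure_map hsm
      have : IsProbabilityMeasure (P.map (Y a)) := Measure.isProbabilityMeasure_map (hm a)
      have hν : ∀ᵐ y ∂(P.map (Y a)), ‖y‖ ≤ c := by
        rw [ae_map_iff (hm a) (measurableSet_le measurable_norm measurable_const)]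
        exact hb a
      have hν0 : ∫ y, y ∂(P.map (Y a)) = 0 := by
        exact (integral_map (hm a) aestronglyMeasurable_id).trans (h0 a)
      rw [Finset.sum_insert ha, add_comm (Y a),
        (hY.indepFun_finsetSum_of_notMem₀ hm ha).map_add_eq_map_conv_map₀ hsm (hm a),
        Finset.card_insert_of_notMem ha]
      refine ⟨⟨R + c, ae_norm_le_conv hR hν⟩, fun g hg => ?_, ?_⟩
      · refine (hg.integral_exp_conv_le hc hR hν hexp).trans (le_of_eq ?_)
        push_cast; ring_nf
      · rw [integral_norm_sq_conv (𝕜 := 𝕜) hR hν hν0]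
        have : ∫ y, ‖y‖ ^ 2 ∂(P.map (Y a)) ≤ c ^ 2 := by
          calc _ ≤ ∫ y, c ^ 2 ∂(P.map (Y a)) := by
                refine integral_mono_of_nonneg (Filter.Eventually.of_forall fun _ => by positivity)
                  (integrable_const _) ?_
                filter_upwards [hν] with y hy
                gcongr
            _ = c ^ 2 := by simp
        push_cast; linarith
  obtain ⟨⟨R, hR⟩, hexp, hsq⟩ := key Finset.univ
  have hsm : AEMeasurable (∑ i, Y i) P := Finset.aemeasurable_sum _ fun i _ => hm i
  have : IsProbabilityMeasure (P.map (∑ i, Y i)) := Measure.isProbabilityMeasure_map hsm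
  set κ := P.map (∑ i, Y i) with hκ
  have hmean : ∫ x, ‖x‖ ∂κ ≤ √(Fintype.card ι) * c := by
    have hi : Integrable (fun x : E => ‖x‖) κ :=
      integrable_of_ae_norm_le hR continuous_norm fun x hx => by simpa using hx
    have hi2 : Integrable (fun x : E => ‖x‖ ^ 2) κ :=
      integrable_of_ae_norm_le (K := R ^ 2) hR (by fun_prop) fun x hx => by
        rw [norm_pow, norm_norm]; gcongr
    -- Nonnegativity of the variance of the norm.
    have hv : (∫ x, ‖x‖ ∂κ) ^ 2 ≤ ∫ x, ‖x‖ ^ 2 ∂κ := by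
      have h : 0 ≤ ∫ x, (‖x‖ - ∫ y, ‖y‖ ∂κ) ^ 2 ∂κ := integral_nonneg fun _ => sq_nonneg _
      have e : ∀ x : E, (‖x‖ - ∫ y, ‖y‖ ∂κ) ^ 2
          = ‖x‖ ^ 2 - (2 * ∫ y, ‖y‖ ∂κ) * ‖x‖ + (∫ y, ‖y‖ ∂κ) ^ 2 := fun x => by ring
      simp_rw [e] at h
      rw [integral_add (f := fun x : E => ‖x‖ ^ 2 - (2 * ∫ y, ‖y‖ ∂κ) * ‖x‖)
        (hi2.sub (hi.const_mul _)) (integrable_const _), integral_sub hi2 (hi.const_mul _),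
        integral_const_mul] at h
      simp at h
      linarith
    refine le_of_sq_le_sq (hv.trans (hsq.trans (le_of_eq ?_))) (by positivity)
    rw [mul_pow, Real.sq_sqrt (by positivity), Finset.card_univ]
  have hnorm : AEMeasurable (fun x : E => ‖x‖) κ := measurable_norm.aemeasurable
  have hmk := measure_ge_le_exp_mul_mgf (μ := κ) (X := fun x : E => ‖x‖) r ht
    (lipschitzWith_one_norm.integrable_exp_of_ae_norm_le hR t)
  have hset : P.real {ω | r ≤ ‖∑ i, Y i ω‖} = κ.real {x | r ≤ ‖x‖} := by
    rw [hκ, map_measureReal_apply_of_aemeasurable hsm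
      (measurableSet_le measurable_const measurable_norm)]
    simp [Set.preimage]
  rw [hset]
  refine hmk.trans ?_
  calc Real.exp (-t * r) * mgf (fun x : E => ‖x‖) κ t
      ≤ Real.exp (-t * r) * (Real.exp (t * ∫ x, ‖x‖ ∂κ)
          * Real.exp (Fintype.card ι * (t ^ 2 * c ^ 2 / 2))) := by
        gcongr
        simpa [mgf] using hexp _ lipschitzWith_one_norm
    _ ≤ Real.exp (-t * r) * (Real.exp (t * (√(Fintype.card ι) * c))
          * Real.exp (Fintype.card ι * (t ^ 2 * c ^ 2 / 2))) := by
        gcongr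
    _ = _ := by
        rw [← Real.exp_add, ← Real.exp_add]; ring_nf

end IndependentSums

/-! ### Operator inequalities: rank of the bands and size of a block -/

namespace QuantumCovering

section Operators

set_option linter.unusedSectionVars false

open scoped MatrixOrder

variable {n : Type*} [Fintype n] [DecidableEq n]

theorem continuousOn_spectrum (f : ℝ → ℝ) (A : Matrix n n ℂ) : ContinuousOn f (spectrum ℝ A) :=
  A.finite_real_spectrum.continuousOn f

theorem spectralProj_isSelfAdjoint (s : Set ℝ) (A : Matrix n n ℂ) :
    IsSelfAdjoint (spectralProj s A) :=
  cfc_predicate _ _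

theorem spectralProj_mul_self (s : Set ℝ) (A : Matrix n n ℂ) :
    spectralProj s A * spectralProj s A = spectralProj s A := by
  rw [spectralProj, ← cfc_mul _ _ A (continuousOn_spectrum _ A) (continuousOn_spectrum _ A)]
  congr 1; ext x; by_cases hx : x ∈ s <;> simp [hx]

theorem spectralProj_mul_mul (s : Set ℝ) {A : Matrix n n ℂ} (hA : IsSelfAdjoint A) :
    spectralProj s A * A * spectralProj s A = cfc (s.indicator id) A := by
  nth_rewrite 2 [← cfc_id ℝ A]
  rw [spectralProj, ← cfc_mul _ _ A (continuousOn_spectrum _ A) (continuousOn_spectrum _ A),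
    ← cfc_mul _ _ A (continuousOn_spectrum _ A) (continuousOn_spectrum _ A)]
  congr 1; ext x; by_cases hx : x ∈ s <;> simp [hx]

theorem projGE_conj_nonneg {A B : Matrix n n ℂ} (h : IsSelfAdjoint (A - B)) :
    0 ≤ projGE A B * (A - B) * projGE A B := by
  rw [projGE, spectralProj_mul_mul _ h]
  exact cfc_nonneg fun x _ => Set.indicator_nonneg (fun y hy => hy) x

theorem cutState_le {I : ℝ} {ρ ρx : Matrix n n ℂ} (hρ : IsSelfAdjoint ρ) (hρx : IsSelfAdjoint ρx) :
    cutState I ρ ρx ≤ (2 : ℝ) ^ I • (cutProj I ρ ρx * ρ * cutProj I ρ ρx) := by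
  have h := projGE_conj_nonneg (A := (2 : ℝ) ^ I • ρ) (B := ρx)
    (((IsSelfAdjoint.all _).smul hρ).sub hρx)
  rw [mul_sub, sub_mul, sub_nonneg] at h
  simpa [cutState, cutProj] using h

theorem bandProj_conj_le {ρ : Matrix n n ℂ} (hρ : IsSelfAdjoint ρ) (l : ℕ) :
    bandProj ρ l * ρ * bandProj ρ l ≤ (2 * ((2 : ℝ) ^ l)⁻¹) • (1 : Matrix n n ℂ) := by
  rw [bandProj, spectralProj_mul_mul _ hρ, ← Algebra.algebraMap_eq_smul_one]
  refine cfc_le_algebraMap _ _ _ (fun x _ => ?_) (continuousOn_spectrum _ _)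
  refine Set.indicator_apply_le' (fun hx => hx.2.trans (le_of_eq ?_)) fun _ => by positivity
  rw [neg_sub, zpow_sub₀ two_ne_zero, zpow_one, zpow_natCast, div_eq_mul_inv]

/-- Markov's inequality in operator form: the indicator of the band is at most `2^l x` for `x ≥ 0`.
Taking traces bounds the rank of the band. -/
theorem bandProj_le {ρ : Matrix n n ℂ} (hρ : ρ.PosSemidef) (l : ℕ) :
    bandProj ρ l ≤ (2 : ℝ) ^ l • ρ := by
  have hsa : IsSelfAdjoint ρ := hρ.1
  rw [← cfc_const_mul_id ((2 : ℝ) ^ l) ρ, bandProj, spectralProj]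
  refine cfc_mono (fun x hx => ?_) (continuousOn_spectrum _ _) (continuousOn_spectrum _ _)
  have hx0 : 0 ≤ x := spectrum_nonneg_of_nonneg (Matrix.nonneg_iff_posSemidef.2 hρ) hx
  refine Set.indicator_apply_le' (fun h => ?_) fun _ => by positivity
  have h1 := h.1.le
  rw [zpow_neg, zpow_natCast, inv_le_iff_one_le_mul₀' (by positivity)] at h1
  exact h1

theorem trace_re_mono {A B : Matrix n n ℂ} (h : A ≤ B) : A.trace.re ≤ B.trace.re := by
  have := (Matrix.le_iff.1 h).trace_nonneg
  rw [Matrix.trace_sub] at this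
  have := (Complex.le_def.1 this).1
  simpa using this

/-- A projection has eigenvalues 0 and 1 only, so its trace counts the nonzero ones. -/
theorem rank_spectralProj (s : Set ℝ) (A : Matrix n n ℂ) :
    ((spectralProj s A).rank : ℝ) = (spectralProj s A).trace.re := by
  have hP : (spectralProj s A).IsHermitian := spectralProj_isSelfAdjoint s A
  rw [hP.rank_eq_card_non_zero_eigs, hP.trace_eq_sum_eigenvalues, Fintype.card_subtype,
    Finset.card_filter]
  push_cast
  rw [Complex.re_sum]
  refine Finset.sum_congr rfl fun j _ => ?_
  have h := hP.mulVec_eigenvectorBasis j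
  have h01 : hP.eigenvalues j = 0 ∨ hP.eigenvalues j = 1 := by
    have hQ : hP.eigenvalues j • (spectralProj s A).mulVec (hP.eigenvectorBasis j)
        = (spectralProj s A).mulVec (hP.eigenvectorBasis j) := by
      have hv : ∀ v, (spectralProj s A).mulVec ((spectralProj s A).mulVec v)
          = (spectralProj s A).mulVec v := fun v => by
        rw [Matrix.mulVec_mulVec, spectralProj_mul_self]
      have := hv (hP.eigenvectorBasis j)
      rwa [h, Matrix.mulVec_smul, ← h] at this
    rw [h, smul_smul, ← sub_eq_zero, ← sub_smul, smul_eq_zero] at hQ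
    have hne : (hP.eigenvectorBasis j : n → ℂ) ≠ 0 := by
      have := hP.eigenvectorBasis.orthonormal.ne_zero j
      simpa using this
    have := hQ.resolve_right hne
    have : hP.eigenvalues j * (hP.eigenvalues j - 1) = 0 := by linarith
    rcases mul_eq_zero.1 this with h | h
    · exact Or.inl h
    · exact Or.inr (by linarith)
  rcases h01 with h | h <;> simp [h]

theorem rank_bandProj_le {ρ : Matrix n n ℂ} (hρ : IsState ρ) (l : ℕ) :
    ((bandProj ρ l).rank : ℝ) ≤ 2 ^ l := by
  rw [bandProj, rank_spectralProj]
  refine (trace_re_mono (bandProj_le hρ.posSemidef l)).trans (le_of_eq ?_)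
  rw [Matrix.trace_smul, hρ.trace_eq_one, Complex.real_smul, mul_one, Complex.ofReal_re]

/-- Inside the range of a projection `E` that contains the range of `H`, the complement of the
positive part of `H` is a projection on which `H` is nonpositive. -/
theorem sub_spectralProj_Ioi {E H : Matrix n n ℂ} (hE : IsSelfAdjoint E) (hE2 : E * E = E)
    (hH : IsSelfAdjoint H) (hEH : E * H = H) :
    IsSelfAdjoint (E - spectralProj (Set.Ioi 0) H) ∧
    (E - spectralProj (Set.Ioi 0) H) * (E - spectralProj (Set.Ioi 0) H)
      = E - spectralProj (Set.Ioi 0) H ∧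
    E * (E - spectralProj (Set.Ioi 0) H) = E - spectralProj (Set.Ioi 0) H ∧
    (E - spectralProj (Set.Ioi 0) H) * E = E - spectralProj (Set.Ioi 0) H ∧
    (E - spectralProj (Set.Ioi 0) H) * H * (E - spectralProj (Set.Ioi 0) H) ≤ 0 := by
  have hHE : H * E = H := by
    have := congrArg star hEH
    rwa [star_mul, hE.star_eq, hH.star_eq] at this
  have hGs := spectralProj_isSelfAdjoint (Set.Ioi 0) H
  have hG2 := spectralProj_mul_self (Set.Ioi 0) H
  -- The factor `H` on the left puts the range of the positive spectral projector inside that of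
  -- `H`, hence inside that of `E`.
  have hG : spectralProj (Set.Ioi 0) H = H * cfc ((Set.Ioi 0).indicator fun x : ℝ => x⁻¹) H := by
    nth_rewrite 2 [← cfc_id ℝ H]
    rw [spectralProj, ← cfc_mul _ _ H (continuousOn_spectrum _ H) (continuousOn_spectrum _ H)]
    congr 1; ext x
    by_cases hx : 0 < x
    · simp [hx, hx.ne']
    · simp [hx]
  have hEG : E * spectralProj (Set.Ioi 0) H = spectralProj (Set.Ioi 0) H := by
    rw [hG, ← mul_assoc, hEH]
  have hGE : spectralProj (Set.Ioi 0) H * E = spectralProj (Set.Ioi 0) H := by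
    have := congrArg star hEG
    rwa [star_mul, hE.star_eq, hGs.star_eq] at this
  refine ⟨hE.sub hGs, ?_, ?_, ?_, ?_⟩
  · rw [sub_mul, mul_sub, mul_sub, hE2, hEG, hGE, hG2]; abel
  · rw [mul_sub, hE2, hEG]
  · rw [sub_mul, hE2, hGE]
  · have hGH : spectralProj (Set.Ioi 0) H * H = cfc ((Set.Ioi 0).indicator (id : ℝ → ℝ)) H := by
      nth_rewrite 2 [← cfc_id ℝ H]
      rw [spectralProj, ← cfc_mul _ _ H (continuousOn_spectrum _ H) (continuousOn_spectrum _ H)]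
      congr 1; ext x; by_cases hx : 0 < x <;> simp [hx]
    have hHG : H * spectralProj (Set.Ioi 0) H = cfc ((Set.Ioi 0).indicator (id : ℝ → ℝ)) H := by
      have := congrArg star hGH
      rwa [star_mul, hGs.star_eq, hH.star_eq, (cfc_predicate _ H : IsSelfAdjoint _).star_eq] at this
    -- The compression is `H` minus its positive part.
    have e : (E - spectralProj (Set.Ioi 0) H) * H * (E - spectralProj (Set.Ioi 0) H)
        = H - cfc ((Set.Ioi 0).indicator (id : ℝ → ℝ)) H := by
      rw [sub_mul, mul_sub, sub_mul, sub_mul, hEH, hHE, hHG, spectralProj_mul_mul _ hH, mul_assoc,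
        hHE, hGH]
      abel
    rw [e, sub_nonpos]
    nth_rewrite 1 [← cfc_id ℝ H]
    refine cfc_mono (fun x _ => ?_) (continuousOn_spectrum _ _) (continuousOn_spectrum _ _)
    by_cases hx : 0 < x
    · simp [hx]
    · simpa [hx] using le_of_not_gt hx

theorem projection_le_one {P : Matrix n n ℂ} (hP : IsSelfAdjoint P) (hP2 : P * P = P) : P ≤ 1 := by
  rw [← sub_nonneg]
  have : (1 - P) = star (1 - P) * (1 - P) := by
    rw [star_sub, star_one, hP.star_eq, mul_sub, sub_mul, sub_mul, hP2]; simp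
  rw [this]
  exact star_mul_self_nonneg _

/-- With `R = S²`, cyclicity turns the left trace into that of `S P S`, and `P ≤ 1`. -/
theorem trace_projection_conj_le {P R : Matrix n n ℂ} (hP : IsSelfAdjoint P) (hP2 : P * P = P)
    (hR : 0 ≤ R) : (P * R * P).trace.re ≤ R.trace.re := by
  obtain ⟨S, hS, rfl⟩ : ∃ S : Matrix n n ℂ, IsSelfAdjoint S ∧ S * S = R :=
    ⟨CFC.sqrt R, (CFC.sqrt_nonneg R).isSelfAdjoint, CFC.sqrt_mul_sqrt_self R hR⟩
  have h := trace_re_mono (star_left_conjugate_le_conjugate (projection_le_one hP hP2) S)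
  rw [hS.star_eq, mul_one] at h
  refine le_trans (le_of_eq ?_) h
  rw [Matrix.trace_mul_comm, ← mul_assoc, hP2, ← mul_assoc, Matrix.trace_mul_comm, ← mul_assoc]

/-- The squared Frobenius norm of `P R Q`, for projections `P` and `Q` and a subnormalised state
`R`, is at most the norm of `Q R Q`. -/
theorem trace_conj_mul_le {P Q R : Matrix n n ℂ} (hP : IsSelfAdjoint P) (hP2 : P * P = P)
    (hQ : IsSelfAdjoint Q) (hR : 0 ≤ R) (hR1 : R.trace.re ≤ 1) {b : ℝ} (hb : 0 ≤ b)
    (h : Q * R * Q ≤ b • (1 : Matrix n n ℂ)) :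
    ((P * R * Q) * star (P * R * Q)).trace.re ≤ b := by
  obtain ⟨S, hS, rfl⟩ : ∃ S : Matrix n n ℂ, IsSelfAdjoint S ∧ S * S = R :=
    ⟨CFC.sqrt R, (CFC.sqrt_nonneg R).isSelfAdjoint, CFC.sqrt_mul_sqrt_self R hR⟩
  -- By the C⋆-identity `(SQ)⋆(SQ) = Q R Q` and `(SQ)(SQ)⋆` have the same norm, so the bound moves
  -- to the factor in the middle of `P S (SQ)(SQ)⋆ S P`.
  have hB : S * Q * star (S * Q) ≤ b • (1 : Matrix n n ℂ) := by
    open scoped Matrix.Norms.L2Operator in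
    rw [← Algebra.algebraMap_eq_smul_one] at h ⊢
    have h1 : Q * (S * S) * Q = star (S * Q) * (S * Q) := by
      rw [star_mul, hQ.star_eq, hS.star_eq]; simp only [mul_assoc]
    rw [h1, ← CStarAlgebra.norm_le_iff_le_algebraMap _ hb (star_mul_self_nonneg _),
      CStarRing.norm_star_mul_self] at h
    rwa [← CStarAlgebra.norm_le_iff_le_algebraMap _ hb (mul_star_self_nonneg _),
      CStarRing.norm_self_mul_star]
  have h1 : (P * (S * S) * Q) * star (P * (S * S) * Q)
      = (P * S) * (S * Q * star (S * Q)) * star (P * S) := by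
    simp only [star_mul, hQ.star_eq, hS.star_eq, hP.star_eq, mul_assoc]
  have h2 := star_right_conjugate_le_conjugate hB (P * S)
  rw [← h1] at h2
  refine (trace_re_mono h2).trans ?_
  have h5 : P * S * (b • 1) * star (P * S) = b • (P * (S * S) * P) := by
    simp [star_mul, hS.star_eq, hP.star_eq, mul_assoc]
  have h6 := trace_projection_conj_le hP hP2 hR
  rw [h5, Matrix.trace_smul, Complex.smul_re, smul_eq_mul]
  nlinarith

/-- Cauchy–Schwarz over the nonzero singular values, whose number is the rank. -/
theorem traceNorm_sq_le (A : Matrix n n ℂ) :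
    traceNorm A ^ 2 ≤ A.rank * (star A * A).trace.re := by
  have hH := Matrix.isHermitian_conjTranspose_mul_self A
  have hnn : ∀ j, 0 ≤ hH.eigenvalues j :=
    (Matrix.posSemidef_conjTranspose_mul_self A).eigenvalues_nonneg
  have hr : (A.rank : ℝ) = (Finset.univ.filter fun j => hH.eigenvalues j ≠ 0).card := by
    rw [← Matrix.rank_conjTranspose_mul_self A, hH.rank_eq_card_non_zero_eigs,
      Fintype.card_subtype]
  have ht : (star A * A).trace.re
      = ∑ j ∈ Finset.univ.filter fun j => hH.eigenvalues j ≠ 0, hH.eigenvalues j := by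
    rw [Finset.sum_filter_ne_zero, Matrix.star_eq_conjTranspose, hH.trace_eq_sum_eigenvalues,
      Complex.re_sum]
    simp
  have hn : traceNorm A
      = ∑ j ∈ Finset.univ.filter fun j => hH.eigenvalues j ≠ 0, √(hH.eigenvalues j) := by
    rw [traceNorm]
    exact (Finset.sum_filter_of_ne (p := fun j => hH.eigenvalues j ≠ 0) fun j _ hj h0 => hj (by
      rw [h0, Real.sqrt_zero])).symm
  rw [hr, ht, hn]
  refine sq_sum_le_card_mul_sum_sq.trans (le_of_eq ?_)
  congr 1
  exact Finset.sum_congr rfl fun j _ => Real.sq_sqrt (hnn j)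

theorem trace_cutState_le {I : ℝ} {ρ ρx : Matrix n n ℂ} (hρx : IsState ρx) :
    (cutState I ρ ρx).trace.re ≤ 1 := by
  have := trace_projection_conj_le
    (spectralProj_isSelfAdjoint (Set.Ici 0) ((2 : ℝ) ^ I • ρ - ρx))
    (spectralProj_mul_self (Set.Ici 0) ((2 : ℝ) ^ I • ρ - ρx))
    (Matrix.nonneg_iff_posSemidef.2 hρx.posSemidef)
  rwa [hρx.trace_eq_one, Complex.one_re] at this

theorem cutState_nonneg {I : ℝ} {ρ ρx : Matrix n n ℂ} (hρx : ρx.PosSemidef) :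
    0 ≤ cutState I ρ ρx := by
  have hC := spectralProj_isSelfAdjoint (Set.Ici 0) ((2 : ℝ) ^ I • ρ - ρx)
  have := star_left_conjugate_nonneg (Matrix.nonneg_iff_posSemidef.2 hρx) (cutProj I ρ ρx)
  rwa [cutProj, projGE, hC.star_eq] at this

section Block

variable {I : ℝ} {ρ ρx : Matrix n n ℂ}

theorem bandMinus_spec (hρ : IsSelfAdjoint ρ) (l : ℕ) :
    IsSelfAdjoint (bandMinus I ρ ρx l) ∧
    bandMinus I ρ ρx l * bandMinus I ρ ρx l = bandMinus I ρ ρx l ∧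
    bandProj ρ l * bandMinus I ρ ρx l = bandMinus I ρ ρx l ∧
    bandMinus I ρ ρx l * bandProj ρ l = bandMinus I ρ ρx l ∧
    bandMinus I ρ ρx l * (bandProj ρ l * cutProj I ρ ρx * ρ * cutProj I ρ ρx * bandProj ρ l -
      (4 : ℝ) • (bandProj ρ l * ρ * bandProj ρ l)) * bandMinus I ρ ρx l ≤ 0 := by
  have hE : IsSelfAdjoint (bandProj ρ l) := spectralProj_isSelfAdjoint _ _
  have hE2 : bandProj ρ l * bandProj ρ l = bandProj ρ l := spectralProj_mul_self _ _
  have hC : IsSelfAdjoint (cutProj I ρ ρx) := spectralProj_isSelfAdjoint _ _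
  refine sub_spectralProj_Ioi hE hE2 ?_ ?_
  · refine IsSelfAdjoint.sub ?_ ((IsSelfAdjoint.all _).smul ?_)
    · simp only [isSelfAdjoint_iff, star_mul, hE.star_eq, hC.star_eq, hρ.star_eq, mul_assoc]
    · simp only [isSelfAdjoint_iff, star_mul, hE.star_eq, hρ.star_eq, mul_assoc]
  · rw [mul_sub, mul_smul_comm]
    simp only [← mul_assoc, hE2]

/-- The cut costs `2^I`, the restriction to `Π⁻` costs 4, and the upper edge of the band is `2 ·
2^(-l)`. -/
theorem bandMinus_conj_cutState_le (hρ : IsSelfAdjoint ρ) (hρx : IsSelfAdjoint ρx) (l : ℕ) :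
    bandMinus I ρ ρx l * cutState I ρ ρx * bandMinus I ρ ρx l
      ≤ (8 * (2 : ℝ) ^ I * ((2 : ℝ) ^ l)⁻¹) • (1 : Matrix n n ℂ) := by
  obtain ⟨hQ, hQ2, hEQ, hQE, hle⟩ := bandMinus_spec (I := I) (ρx := ρx) hρ l
  set Q := bandMinus I ρ ρx l
  set E := bandProj ρ l
  set C := cutProj I ρ ρx
  have h1 : Q * cutState I ρ ρx * Q ≤ (2 : ℝ) ^ I • (Q * (C * ρ * C) * Q) := by
    have := star_left_conjugate_le_conjugate (cutState_le (I := I) hρ hρx) Q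
    rwa [hQ.star_eq, mul_smul_comm, smul_mul_assoc] at this
  have h2 : Q * (C * ρ * C) * Q ≤ (4 : ℝ) • (Q * (E * ρ * E) * Q) := by
    rw [mul_sub, sub_mul, sub_nonpos, mul_smul_comm, smul_mul_assoc] at hle
    refine le_trans (le_of_eq ?_) hle
    calc Q * (C * ρ * C) * Q = (Q * E) * (C * ρ * C) * (E * Q) := by rw [hQE, hEQ]
      _ = _ := by simp only [mul_assoc]
  have h3 : Q * (E * ρ * E) * Q ≤ (2 * ((2 : ℝ) ^ l)⁻¹) • (1 : Matrix n n ℂ) := by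
    have := star_left_conjugate_le_conjugate (bandProj_conj_le hρ l) Q
    rw [hQ.star_eq, mul_smul_comm, smul_mul_assoc, mul_one, hQ2] at this
    exact this.trans (smul_le_smul_of_nonneg_left (projection_le_one hQ hQ2) (by positivity))
  calc _ ≤ (2 : ℝ) ^ I • (Q * (C * ρ * C) * Q) := h1
    _ ≤ (2 : ℝ) ^ I • (4 : ℝ) • (Q * (E * ρ * E) * Q) :=
        smul_le_smul_of_nonneg_left h2 (by positivity)
    _ ≤ (2 : ℝ) ^ I • (4 : ℝ) • (2 * ((2 : ℝ) ^ l)⁻¹) • (1 : Matrix n n ℂ) :=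
        smul_le_smul_of_nonneg_left (smul_le_smul_of_nonneg_left h3 (by positivity))
          (by positivity)
    _ = _ := by rw [smul_smul, smul_smul]; congr 1; ring

/-- A block and its adjoint have equal Frobenius norm, so the sharper of the two band bounds, that
of the larger index, may be used. -/
theorem frobenius_offDiagBlock_le (hρ : IsSelfAdjoint ρ) (hρx : IsState ρx) (i l : ℕ) :
    (star (offDiagBlock I ρ i l ρx) * offDiagBlock I ρ i l ρx).trace.re
      ≤ 8 * (2 : ℝ) ^ I * ((2 : ℝ) ^ max i l)⁻¹ := by
  have hx : IsSelfAdjoint ρx := hρx.posSemidef.1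
  have hR := cutState_nonneg (I := I) (ρ := ρ) hρx.posSemidef
  have hR1 := trace_cutState_le (I := I) (ρ := ρ) hρx
  obtain ⟨hQi, hQi2, -⟩ := bandMinus_spec (I := I) (ρx := ρx) hρ i
  obtain ⟨hQl, hQl2, -⟩ := bandMinus_spec (I := I) (ρx := ρx) hρ l
  rcases le_total i l with h | h
  · rw [max_eq_right h, Matrix.trace_mul_comm]
    exact trace_conj_mul_le hQi hQi2 hQl hR hR1 (by positivity)
      (bandMinus_conj_cutState_le hρ hx l)
  · rw [max_eq_left h]
    have := trace_conj_mul_le hQl hQl2 hQi hR hR1 (by positivity)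
      (bandMinus_conj_cutState_le (I := I) hρ hx i)
    refine le_trans (le_of_eq ?_) this
    simp only [offDiagBlock, star_mul, hQi.star_eq, hQl.star_eq,
      hR.isSelfAdjoint.star_eq, mul_assoc]

theorem bandProj_mul_offDiagBlock (hρ : IsSelfAdjoint ρ) (i l : ℕ) :
    bandProj ρ i * offDiagBlock I ρ i l ρx = offDiagBlock I ρ i l ρx := by
  rw [offDiagBlock, ← mul_assoc, ← mul_assoc, (bandMinus_spec hρ i).2.2.1]

theorem offDiagBlock_mul_bandProj (hρ : IsSelfAdjoint ρ) (i l : ℕ) :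
    offDiagBlock I ρ i l ρx * bandProj ρ l = offDiagBlock I ρ i l ρx := by
  rw [offDiagBlock, mul_assoc, (bandMinus_spec hρ l).2.2.2.1]

end Block

end Operators
end QuantumCovering

/-! ### Measurability, Frobenius norm and matrix expectation -/

namespace QuantumCovering

-- Weierstrass on `[-k, k]` with error `1/(k+1)`; every point eventually lies in the interval.
-- Polynomials in a random matrix are visibly measurable, which is why they are wanted.
open Filter Topology Polynomial in
theorem exists_polynomial_tendsto {f : ℝ → ℝ} {F : ℕ → ℝ → ℝ} (hF : ∀ k, Continuous (F k))
    (hf : ∀ x, Tendsto (fun k => F k x) atTop (𝓝 (f x))) :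
    ∃ p : ℕ → ℝ[X], ∀ x, Tendsto (fun k => (p k).eval x) atTop (𝓝 (f x)) := by
  choose p hp using fun k : ℕ => exists_polynomial_near_of_continuousOn (-(k : ℝ)) k (F k)
    (hF k).continuousOn (1 / ((k : ℝ) + 1)) (by positivity)
  refine ⟨p, fun x => ?_⟩
  have h1 : Tendsto (fun k => (p k).eval x - F k x) atTop (𝓝 0) := by
    refine squeeze_zero_norm' ?_ tendsto_one_div_add_atTop_nhds_zero_nat
    obtain ⟨N, hN⟩ := exists_nat_ge |x|
    filter_upwards [eventually_ge_atTop N] with k hk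
    have hk' : (N : ℝ) ≤ k := by exact_mod_cast hk
    exact (hp k x (abs_le.1 (hN.trans hk'))).le
  simpa using h1.add (hf x)

section Measurability

variable {n 𝒳 : Type*} [Fintype n] [MeasurableSpace 𝒳]

theorem measurable_entry_mul {A B : 𝒳 → Matrix n n ℂ} (hA : ∀ a b, Measurable fun x => A x a b)
    (hB : ∀ a b, Measurable fun x => B x a b) (a b : n) :
    Measurable fun x => (A x * B x) a b := by
  simp only [Matrix.mul_apply]
  exact Finset.measurable_fun_sum _ fun j _ => (hA a j).mul (hB j b)

variable [DecidableEq n]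

theorem measurable_entry_aeval {A : 𝒳 → Matrix n n ℂ} (hA : ∀ a b, Measurable fun x => A x a b)
    (p : Polynomial ℝ) (a b : n) : Measurable fun x => (Polynomial.aeval (A x) p) a b := by
  have hpow : ∀ k : ℕ, ∀ a b, Measurable fun x => (A x ^ k) a b := by
    intro k
    induction k with
    | zero => intro a b; simp only [pow_zero]; exact measurable_const
    | succ k ih => simp only [pow_succ]; exact measurable_entry_mul ih hA
  simp only [Polynomial.aeval_eq_sum_range, Matrix.sum_apply, Matrix.smul_apply]
  exact Finset.measurable_fun_sum _ fun k _ => (hpow k a b).const_smul (p.coeff k)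

open Filter Topology in
theorem tendsto_cfc_entry {A : Matrix n n ℂ} (hA : A.IsHermitian) {f : ℝ → ℝ} {F : ℕ → ℝ → ℝ}
    (hf : ∀ x, Tendsto (fun k => F k x) atTop (𝓝 (f x))) (a b : n) :
    Tendsto (fun k => cfc (F k) A a b) atTop (𝓝 (cfc f A a b)) := by
  have e : ∀ g : ℝ → ℝ, cfc g A a b = ∑ j, (hA.eigenvectorUnitary : Matrix n n ℂ) a j
      * (g (hA.eigenvalues j) : ℂ) * star (hA.eigenvectorUnitary : Matrix n n ℂ) j b := fun g => by
    rw [hA.cfc_eq, Matrix.IsHermitian.cfc, Unitary.conjStarAlgAut_apply, Matrix.mul_apply]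
    simp only [Matrix.mul_diagonal, Function.comp_apply]
    rfl
  simp only [e]
  refine tendsto_finsetSum _ fun j _ => Tendsto.mul_const _ (Tendsto.const_mul _ ?_)
  exact ((Complex.continuous_ofReal.tendsto _).comp (hf (hA.eigenvalues j)))

open Filter Topology in
/-- The functional calculus of a Hermitian random matrix is measurable for a pointwise limit of
continuous functions. -/
theorem measurable_entry_cfc {A : 𝒳 → Matrix n n ℂ} (hA : ∀ a b, Measurable fun x => A x a b)
    (hH : ∀ x, (A x).IsHermitian) {f : ℝ → ℝ} {F : ℕ → ℝ → ℝ} (hF : ∀ k, Continuous (F k))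
    (hf : ∀ x, Tendsto (fun k => F k x) atTop (𝓝 (f x))) (a b : n) :
    Measurable fun x => cfc f (A x) a b := by
  obtain ⟨p, hp⟩ := exists_polynomial_tendsto hF hf
  refine measurable_of_tendsto_metrizable (f := fun k x => Polynomial.aeval (A x) (p k) a b)
    (fun k => measurable_entry_aeval hA _ a b) (tendsto_pi_nhds.2 fun x => ?_)
  have := tendsto_cfc_entry (hH x) hp a b
  refine this.congr fun k => ?_
  exact congrFun (congrFun (cfc_polynomial (p k) (A x) (hH x)) a) b

open Filter Topology in
theorem measurable_entry_spectralProj_Ioi {A : 𝒳 → Matrix n n ℂ}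
    (hA : ∀ a b, Measurable fun x => A x a b) (hH : ∀ x, (A x).IsHermitian) (a b : n) :
    Measurable fun x => spectralProj (Set.Ioi 0) (A x) a b := by
  -- These ramps vanish at 0, so the limit excludes 0.
  refine measurable_entry_cfc hA hH (F := fun k x => max 0 (min 1 (k * x)))
    (fun k => by fun_prop) (fun x => ?_) a b
  rcases le_or_gt x 0 with hx | hx
  · have : ∀ k : ℕ, max 0 (min 1 ((k : ℝ) * x)) = 0 := fun k =>
      max_eq_left ((min_le_right _ _).trans (mul_nonpos_of_nonneg_of_nonpos k.cast_nonneg hx))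
    simp [this, hx]
  · obtain ⟨N, hN⟩ := exists_nat_ge x⁻¹
    refine tendsto_const_nhds.congr' ?_
    filter_upwards [eventually_ge_atTop N] with k hk
    have hk' : x⁻¹ ≤ k := hN.trans (by exact_mod_cast hk)
    have : 1 ≤ (k : ℝ) * x := (inv_le_iff_one_le_mul₀ hx).1 hk'
    simp [hx, this]

open Filter Topology in
theorem measurable_entry_spectralProj_Ici {A : 𝒳 → Matrix n n ℂ}
    (hA : ∀ a b, Measurable fun x => A x a b) (hH : ∀ x, (A x).IsHermitian) (a b : n) :
    Measurable fun x => spectralProj (Set.Ici 0) (A x) a b := by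
  -- Shifted ramps, equal to 1 at 0, so the limit includes 0.
  refine measurable_entry_cfc hA hH (F := fun k x => max 0 (min 1 (1 + k * x)))
    (fun k => by fun_prop) (fun x => ?_) a b
  rcases lt_or_ge x 0 with hx | hx
  · obtain ⟨N, hN⟩ := exists_nat_ge (-x)⁻¹
    refine tendsto_const_nhds.congr' ?_
    filter_upwards [eventually_ge_atTop N] with k hk
    have hk' : (-x)⁻¹ ≤ k := hN.trans (by exact_mod_cast hk)
    have : 1 ≤ (k : ℝ) * (-x) := (inv_le_iff_one_le_mul₀ (by linarith)).1 hk'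
    rw [Set.indicator_of_notMem (by simpa using hx), max_eq_left]
    exact (min_le_right _ _).trans (by linarith)
  · have : ∀ k : ℕ, min 1 (1 + (k : ℝ) * x) = 1 := fun k =>
      min_eq_left (by have := mul_nonneg (k.cast_nonneg (α := ℝ)) hx; linarith)
    simp [this, hx]

theorem measurable_entry_offDiagBlock {ρ : 𝒳 → Matrix n n ℂ} {τ : Matrix n n ℂ}
    (hρ : ∀ a b, Measurable fun x => ρ x a b) (hH : ∀ x, (ρ x).IsHermitian) (hτ : τ.IsHermitian)
    (I : ℝ) (i l : ℕ) (a b : n) : Measurable fun x => offDiagBlock I τ i l (ρ x) a b := by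
  have hc : ∀ (A : Matrix n n ℂ) (a b : n), Measurable fun _ : 𝒳 => A a b :=
    fun A a b => measurable_const
  have hτs : IsSelfAdjoint τ := hτ
  have hC : ∀ a b, Measurable fun x => cutProj I τ (ρ x) a b :=
    measurable_entry_spectralProj_Ici (fun a b => (hc _ a b).sub (hρ a b))
      fun x => ((IsSelfAdjoint.all ((2 : ℝ) ^ I)).smul hτs).sub (hH x)
  have hS : ∀ a b, Measurable fun x => cutState I τ (ρ x) a b :=
    measurable_entry_mul (measurable_entry_mul hC hρ) hC
  have hQ : ∀ i a b, Measurable fun x => bandMinus I τ (ρ x) i a b := by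
    intro i a b
    refine (hc (bandProj τ i) a b).sub (measurable_entry_spectralProj_Ioi (fun a b => ?_)
      (fun x => ?_) a b)
    · exact (measurable_entry_mul (measurable_entry_mul (measurable_entry_mul
        (measurable_entry_mul (hc _) hC) (hc _)) hC) (hc _) a b).sub (hc _ a b)
    · have hE : IsSelfAdjoint (bandProj τ i) := spectralProj_isSelfAdjoint _ _
      have hC : IsSelfAdjoint (cutProj I τ (ρ x)) := spectralProj_isSelfAdjoint _ _
      refine IsSelfAdjoint.sub ?_ ((IsSelfAdjoint.all _).smul ?_)
      · simp only [isSelfAdjoint_iff, star_mul, hE.star_eq, hC.star_eq, hτs.star_eq, mul_assoc]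
      · simp only [isSelfAdjoint_iff, star_mul, hE.star_eq, hτs.star_eq, mul_assoc]
  exact measurable_entry_mul (measurable_entry_mul (hQ i) hS) (hQ l) a b

end Measurability

section Frobenius

set_option linter.unusedSectionVars false

variable {n : Type*} [Fintype n]

/-- A matrix as a vector of the Euclidean space of its entries. -/
def vec (A : Matrix n n ℂ) : EuclideanSpace ℂ (n × n) :=
  WithLp.toLp 2 fun p => A p.1 p.2

theorem norm_vec_sq (A : Matrix n n ℂ) : ‖vec A‖ ^ 2 = (star A * A).trace.re := by
  rw [EuclideanSpace.norm_sq_eq, Fintype.sum_prod_type, Finset.sum_comm, Matrix.trace,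
    Complex.re_sum]
  refine Finset.sum_congr rfl fun b _ => ?_
  rw [Matrix.diag_apply, Matrix.mul_apply, Complex.re_sum]
  refine Finset.sum_congr rfl fun a _ => ?_
  rw [Matrix.star_apply, ← Complex.normSq_eq_norm_sq, ← Complex.ofReal_re (Complex.normSq _),
    Complex.normSq_eq_conj_mul_self]
  rfl

theorem norm_entry_le (A : Matrix n n ℂ) (a b : n) : ‖A a b‖ ≤ ‖vec A‖ :=
  PiLp.norm_apply_le (vec A) (a, b)

theorem vec_sub (A B : Matrix n n ℂ) : vec (A - B) = vec A - vec B := rfl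

theorem vec_smul (c : ℝ) (A : Matrix n n ℂ) : vec (c • A) = c • vec A := rfl

theorem vec_sum {ι : Type*} (s : Finset ι) (A : ι → Matrix n n ℂ) :
    vec (∑ j ∈ s, A j) = ∑ j ∈ s, vec (A j) := by
  ext p
  simp [vec, Matrix.sum_apply]

end Frobenius

section Expectation

open scoped MatrixOrder

variable {n 𝒳 : Type*} [Fintype n] [MeasurableSpace 𝒳] {μ : Measure 𝒳}

theorem mul_expect {A : 𝒳 → Matrix n n ℂ} (hA : ∀ a b, Integrable (fun x => A x a b) μ)
    (B : Matrix n n ℂ) : B * expect μ A = expect μ fun x => B * A x := by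
  ext a b
  simp only [expect, Matrix.mul_apply, Matrix.of_apply]
  rw [integral_finsetSum _ fun j _ => (hA j b).const_mul _]
  simp only [integral_const_mul]

theorem expect_mul {A : 𝒳 → Matrix n n ℂ} (hA : ∀ a b, Integrable (fun x => A x a b) μ)
    (B : Matrix n n ℂ) : expect μ A * B = expect μ fun x => A x * B := by
  ext a b
  simp only [expect, Matrix.mul_apply, Matrix.of_apply]
  rw [integral_finsetSum _ fun j _ => (hA a j).mul_const _]
  simp only [integral_mul_const]

/-- The square root of a state has Frobenius norm one, so its entries are at most one. The crude
bound only serves integrability. -/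
theorem IsState.norm_entry_le [DecidableEq n] {ρ : Matrix n n ℂ} (hρ : IsState ρ) (a b : n) :
    ‖ρ a b‖ ≤ Fintype.card n := by
  have hR := Matrix.nonneg_iff_posSemidef.2 hρ.posSemidef
  obtain ⟨S, hS, rfl⟩ : ∃ S : Matrix n n ℂ, IsSelfAdjoint S ∧ S * S = ρ :=
    ⟨CFC.sqrt ρ, (CFC.sqrt_nonneg ρ).isSelfAdjoint, CFC.sqrt_mul_sqrt_self ρ hR⟩
  have h1 : ‖vec S‖ ^ 2 = 1 := by
    rw [norm_vec_sq, hS.star_eq, hρ.trace_eq_one, Complex.one_re]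
  have h2 : ∀ a b, ‖S a b‖ ≤ 1 := fun a b => (QuantumCovering.norm_entry_le S a b).trans (by
    nlinarith [norm_nonneg (vec S)])
  rw [Matrix.mul_apply]
  refine (norm_sum_le _ _).trans ?_
  calc ∑ j, ‖S a j * S j b‖ ≤ ∑ j : n, (1 : ℝ) := by
        gcongr with j
        rw [norm_mul]
        exact mul_le_one₀ (h2 _ _) (norm_nonneg _) (h2 _ _)
    _ = _ := by simp

theorem isState_expect [DecidableEq n] [IsProbabilityMeasure μ] {ρ : 𝒳 → Matrix n n ℂ}
    (hρ : ∀ x, IsState (ρ x)) (hm : ∀ a b, Measurable fun x => ρ x a b) :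
    IsState (expect μ ρ) := by
  have hint : ∀ a b, Integrable (fun x => ρ x a b) μ := fun a b =>
    Integrable.of_bound (hm a b).aestronglyMeasurable (Fintype.card n)
      (Filter.Eventually.of_forall fun x => (hρ x).norm_entry_le a b)
  refine ⟨Matrix.PosSemidef.of_dotProduct_mulVec_nonneg ?_ fun v => ?_, ?_⟩
  · ext a b
    rw [Matrix.conjTranspose_apply]
    simp only [expect, Matrix.of_apply]
    rw [← starRingEnd_apply, ← integral_conj]
    congr 1; ext x
    exact (hρ x).posSemidef.1.apply a b
  · have : star v ⬝ᵥ expect μ ρ *ᵥ v = ∫ x, star v ⬝ᵥ ρ x *ᵥ v ∂μ := by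
      simp only [dotProduct, Matrix.mulVec, expect, Matrix.of_apply]
      rw [integral_finsetSum _ fun a _ =>
        (integrable_finsetSum _ fun b _ => (hint a b).mul_const _).const_mul _]
      refine Finset.sum_congr rfl fun a _ => ?_
      rw [integral_const_mul, integral_finsetSum _ fun b _ => (hint a b).mul_const _]
      simp only [integral_mul_const]
    rw [this]
    exact integral_nonneg fun x => (hρ x).posSemidef.dotProduct_mulVec_nonneg v
  · simp only [Matrix.trace, Matrix.diag_apply, expect, Matrix.of_apply]
    rw [← integral_finsetSum _ fun a _ => hint a a]
    have : ∀ x, ∑ a, ρ x a a = 1 := fun x => (hρ x).trace_eq_one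
    simp [this]

end Expectation

end QuantumCovering

/-! ### The random block and the final estimate -/

namespace QuantumCovering

section RandomBlock

set_option linter.unusedSectionVars false

variable {n 𝒳 : Type*} [Fintype n] [DecidableEq n] [MeasurableSpace 𝒳] {μ : Measure 𝒳}
  [IsProbabilityMeasure μ] {ρ : 𝒳 → Matrix n n ℂ} {τ : Matrix n n ℂ}

theorem norm_vec_offDiagBlock_le (hτ : IsState τ) {ρx : Matrix n n ℂ} (hρx : IsState ρx) (I : ℝ)
    (i l : ℕ) : ‖vec (offDiagBlock I τ i l ρx)‖ ≤ √(8 * (2 : ℝ) ^ I * ((2 : ℝ) ^ max i l)⁻¹) := by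
  refine Real.le_sqrt_of_sq_le ?_
  rw [norm_vec_sq]
  exact frobenius_offDiagBlock_le hτ.posSemidef.1 hρx i l

theorem integrable_entry_offDiagBlock (hρ : ∀ x, IsState (ρ x))
    (hm : ∀ a b, Measurable fun x => ρ x a b) (hτ : IsState τ) (I : ℝ) (i l : ℕ) (a b : n) :
    Integrable (fun x => offDiagBlock I τ i l (ρ x) a b) μ :=
  Integrable.of_bound (measurable_entry_offDiagBlock hm (fun x => (hρ x).posSemidef.1)
    hτ.posSemidef.1 I i l a b).aestronglyMeasurable _
    (Filter.Eventually.of_forall fun x =>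
      (norm_entry_le _ a b).trans (norm_vec_offDiagBlock_le hτ (hρ x) I i l))

theorem measurable_vec {A : 𝒳 → Matrix n n ℂ} (hA : ∀ a b, Measurable fun x => A x a b) :
    Measurable fun x => vec (A x) :=
  (WithLp.measurable_toLp 2 _).comp (measurable_pi_lambda _ fun p => hA p.1 p.2)

theorem vec_expect {A : 𝒳 → Matrix n n ℂ} (hv : Integrable (fun x => vec (A x)) μ) :
    vec (expect μ A) = ∫ x, vec (A x) ∂μ := by
  ext p
  exact (EuclideanSpace.proj (𝕜 := ℂ) p).integral_comp_comm hv

/-- The rank of a combination of the blocks is at most the dimension of the smaller band. -/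
theorem rank_le_of_bandProj (hτ : IsState τ) {i l : ℕ} {T : Matrix n n ℂ}
    (hi : bandProj τ i * T = T) (hl : T * bandProj τ l = T) : (T.rank : ℝ) ≤ 2 ^ min i l := by
  rcases le_total i l with h | h
  · rw [min_eq_left h]
    refine le_trans ?_ (rank_bandProj_le hτ i)
    rw [← hi]
    exact_mod_cast Matrix.rank_mul_le_left _ _
  · rw [min_eq_right h]
    refine le_trans ?_ (rank_bandProj_le hτ l)
    rw [← hl]
    exact_mod_cast Matrix.rank_mul_le_right _ _

end RandomBlock

/-- The exponent that results from the optimal choice of the parameter in the Chernoff bound. -/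
theorem chernoff_exponent {r s c M : ℝ} (hM : 0 < M) (hc : 0 < c) (hs : 4 * s ≤ r) (hr : 0 ≤ r) :
    -(r / (2 * M * c ^ 2) * r) + r / (2 * M * c ^ 2) * s
        + M * ((r / (2 * M * c ^ 2)) ^ 2 * c ^ 2 / 2) ≤ -(r ^ 2 / (4 * M * c ^ 2)) := by
  have h : r / (2 * M * c ^ 2) * s ≤ r / (2 * M * c ^ 2) * (r / 4) := by
    gcongr; linarith
  have e : -(r / (2 * M * c ^ 2) * r) + r / (2 * M * c ^ 2) * (r / 4)
      + M * ((r / (2 * M * c ^ 2)) ^ 2 * c ^ 2 / 2) = -(r ^ 2 / (4 * M * c ^ 2)) := by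
    field_simp; ring
  linarith

end QuantumCovering

open QuantumCovering in
theorem theorem7 {n 𝒳 Ω : Type*} [Fintype n] [DecidableEq n]
    [MeasurableSpace 𝒳] [MeasurableSpace Ω]
    (μ : Measure 𝒳) [IsProbabilityMeasure μ]
    (ρ : 𝒳 → Matrix n n ℂ) (hρ : ∀ x, QuantumCovering.IsState (ρ x))
    (hρ_meas : ∀ a b, Measurable fun x => ρ x a b)
    (i l : ℕ) (hil : i ≠ l) (I : ℝ) (hI : 0 < I)
    (P : Measure Ω) [IsProbabilityMeasure P]
    (M : ℕ) (X : Fin M → Ω → 𝒳) (hX_law : ∀ m, HasLaw (X m) μ P) (hX_indep : iIndepFun X P)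
    (ε : ℝ) (hε0 : 0 < ε) (hε1 : ε < 1) :
    P.real {ω | ε ≤ QuantumCovering.traceNorm
        (QuantumCovering.sampleMean (fun m =>
            QuantumCovering.offDiagBlock I (QuantumCovering.expect μ ρ) i l (ρ (X m ω)))
          - QuantumCovering.expect μ (fun x =>
              QuantumCovering.offDiagBlock I (QuantumCovering.expect μ ρ) i l (ρ x)))} ≤
      25 * (Fintype.card n : ℝ) *
        Real.exp (-((10 : ℝ) ^ (-12 : ℤ) * ε ^ 3 * ((M : ℝ) / (2 : ℝ) ^ I))) := by
  set τ := expect μ ρ with hτdef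
  have hτ : IsState τ := isState_expect hρ hρ_meas
  have : Nonempty 𝒳 := μ.nonempty_of_neZero
  have hn : (1 : ℝ) ≤ Fintype.card n := by
    have : Nonempty n := by
      by_contra h
      rw [not_nonempty_iff] at h
      simpa [Matrix.trace] using hτ.trace_eq_one
    exact_mod_cast Fintype.card_pos
  have hK : (0 : ℝ) < 2 ^ I := by positivity
  have hε3 : ε ^ 3 ≤ ε ^ 2 := pow_le_pow_of_le_one hε0.le hε1.le (by norm_num)
  -- For small `M` the exponent is at least `-512 · 10^(-12)`, so the prefactor 25 alone pushes the
  -- right side above one.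
  rcases le_or_gt (ε ^ 2 * M) (512 * 2 ^ I) with hsmall | hlarge
  · refine measureReal_le_one.trans ?_
    have h1 : ε ^ 3 * ((M : ℝ) / (2 : ℝ) ^ I) ≤ 512 := by
      rw [← mul_div_assoc, div_le_iff₀ hK]
      exact (mul_le_mul_of_nonneg_right hε3 M.cast_nonneg).trans hsmall
    have h2 := Real.add_one_le_exp (-((10 : ℝ) ^ (-12 : ℤ) * ε ^ 3 * ((M : ℝ) / (2 : ℝ) ^ I)))
    norm_num at h2 ⊢
    nlinarith
  have hM : (0 : ℝ) < M := by
    by_contra h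
    have : (M : ℝ) = 0 := le_antisymm (not_lt.1 h) M.cast_nonneg
    rw [this] at hlarge
    linarith
  set D : ℝ := 2 ^ min i l with hD
  set C : ℝ := 8 * (2 : ℝ) ^ I * ((2 : ℝ) ^ max i l)⁻¹ with hC
  have hD0 : 0 < D := by positivity
  have hC0 : 0 < C := by positivity
  -- Rank bound times squared Frobenius bound: the band indices disappear because `min i l ≤ max i
  -- l`.
  have hDC : D * C ≤ 8 * 2 ^ I := by
    have h : D ≤ 2 ^ max i l := pow_le_pow_right₀ (by norm_num) min_le_max
    calc D * C = 8 * 2 ^ I * (D * ((2 : ℝ) ^ max i l)⁻¹) := by rw [hC]; ring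
      _ ≤ 8 * 2 ^ I * 1 := by
        gcongr
        rwa [← div_eq_mul_inv, div_le_one (by positivity)]
      _ = _ := mul_one _
  set σ : 𝒳 → Matrix n n ℂ := fun x => offDiagBlock I τ i l (ρ x) with hσ
  have hσm : ∀ a b, Measurable fun x => σ x a b :=
    measurable_entry_offDiagBlock hρ_meas (fun x => (hρ x).posSemidef.1) hτ.posSemidef.1 I i l
  have hσi : ∀ a b, Integrable (fun x => σ x a b) μ :=
    integrable_entry_offDiagBlock hρ hρ_meas hτ I i l
  have hσb : ∀ x, ‖vec (σ x)‖ ≤ √C := fun x => norm_vec_offDiagBlock_le hτ (hρ x) I i l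
  have hvm : Measurable fun x => vec (σ x) := measurable_vec hσm
  have hvi : Integrable (fun x => vec (σ x)) μ :=
    Integrable.of_bound hvm.aestronglyMeasurable _ (Filter.Eventually.of_forall hσb)
  have hmean : vec (expect μ σ) = ∫ x, vec (σ x) ∂μ := vec_expect hvi
  have hmeanb : ‖vec (expect μ σ)‖ ≤ √C := by
    rw [hmean]
    simpa using norm_integral_le_of_norm_le_const (μ := μ) (Filter.Eventually.of_forall hσb)
  -- The factor 2 pays for centring.
  set c : ℝ := 2 * √C with hc
  have hc0 : 0 < c := by positivity
  have hc2 : c ^ 2 = 4 * C := by rw [hc, mul_pow, Real.sq_sqrt hC0.le]; norm_num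
  have hym : Measurable fun x => vec (σ x) - vec (expect μ σ) := hvm.sub_const _
  set Y : Fin M → Ω → EuclideanSpace ℂ (n × n) :=
    fun m ω => vec (σ (X m ω)) - vec (expect μ σ) with hY
  have hYind : iIndepFun Y P := hX_indep.comp (fun _ x => vec (σ x) - vec (expect μ σ)) fun _ => hym
  have hYm : ∀ m, AEMeasurable (Y m) P := fun m => hym.comp_aemeasurable (hX_law m).aemeasurable
  have hYb : ∀ m, ∀ᵐ ω ∂P, ‖Y m ω‖ ≤ c := fun m => Filter.Eventually.of_forall fun ω =>
    (norm_sub_le _ _).trans (by linarith [hσb (X m ω)])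
  have hY0 : ∀ m, ∫ ω, Y m ω ∂P = 0 := fun m => by
    have h := (hX_law m).integral_comp (f := fun x => vec (σ x) - vec (expect μ σ))
      hym.aestronglyMeasurable
    refine h.trans ?_
    rw [integral_sub hvi (integrable_const _), hmean]
    simp
  -- Trace norm at least `ε` and rank at most `D` force Frobenius norm at least `ε / √D`; the factor
  -- `M` undoes the averaging.
  set r : ℝ := ε * M / √D with hr
  have hr0 : 0 ≤ r := by positivity
  have hr2 : r ^ 2 = ε ^ 2 * M ^ 2 / D := by
    rw [hr, div_pow, mul_pow, Real.sq_sqrt hD0.le]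
  have hsub : {ω | ε ≤ traceNorm (sampleMean (fun m => σ (X m ω)) - expect μ σ)}
      ⊆ {ω | r ≤ ‖∑ m, Y m ω‖} := by
    intro ω hω
    set T := sampleMean (fun m => σ (X m ω)) - expect μ σ with hT
    have hω' : ε ≤ traceNorm T := hω
    have hvT : vec T = (M : ℝ)⁻¹ • ∑ m, Y m ω := by
      rw [hT, vec_sub, sampleMean, vec_smul, vec_sum, Finset.sum_sub_distrib, smul_sub,
        Finset.sum_const, Finset.card_univ, Fintype.card_fin, ← Nat.cast_smul_eq_nsmul ℝ,
        smul_smul, inv_mul_cancel₀ hM.ne', one_smul]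
    have hTi : bandProj τ i * T = T := by
      rw [hT, mul_sub, mul_expect hσi, sampleMean, mul_smul_comm, Finset.mul_sum]
      simp only [hσ, bandProj_mul_offDiagBlock (show IsSelfAdjoint τ from hτ.posSemidef.1)]
    have hTl : T * bandProj τ l = T := by
      rw [hT, sub_mul, expect_mul hσi, sampleMean, smul_mul_assoc, Finset.sum_mul]
      simp only [hσ, offDiagBlock_mul_bandProj (show IsSelfAdjoint τ from hτ.posSemidef.1)]
    have h1 : ε ^ 2 ≤ D * ‖vec T‖ ^ 2 := by
      calc ε ^ 2 ≤ traceNorm T ^ 2 := by gcongr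
        _ ≤ T.rank * (star T * T).trace.re := traceNorm_sq_le T
        _ = T.rank * ‖vec T‖ ^ 2 := by rw [norm_vec_sq]
        _ ≤ D * ‖vec T‖ ^ 2 := by gcongr; exact rank_le_of_bandProj hτ hTi hTl
    rw [hvT, norm_smul, mul_pow, Real.norm_eq_abs, sq_abs, inv_pow] at h1
    refine le_of_sq_le_sq ?_ (norm_nonneg _)
    rw [hr2, div_le_iff₀ hD0]
    calc ε ^ 2 * (M : ℝ) ^ 2 ≤ D * (((M : ℝ) ^ 2)⁻¹ * ‖∑ m, Y m ω‖ ^ 2) * (M : ℝ) ^ 2 := by gcongr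
      _ = _ := by field_simp
  -- The mean of the norm is at most a quarter of the deviation. Squared, this reads `64 M D C ≤ ε²
  -- M²`, and `64 · 8` is the threshold 512.
  have h4 : 4 * (√M * c) ≤ r := by
    refine le_of_sq_le_sq ?_ hr0
    rw [hr2, mul_pow, mul_pow, Real.sq_sqrt hM.le, hc2, le_div_iff₀ hD0]
    calc (4 : ℝ) ^ 2 * (M * (4 * C)) * D = 64 * M * (D * C) := by ring
      _ ≤ 64 * M * (8 * 2 ^ I) := by gcongr
      _ = M * (512 * 2 ^ I) := by ring
      _ ≤ M * (ε ^ 2 * M) := by gcongr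
      _ = _ := by ring
  have hmain := hYind.measureReal_le_norm_sum_le ℂ hYm hc0.le hYb hY0 r
    (t := r / (2 * M * c ^ 2)) (by positivity)
  rw [Fintype.card_fin] at hmain
  -- The exponent obtained is at least `ε² M / (128 · 2^I)` in size; `10^(-12)` and the third power
  -- of `ε` are weaker.
  have hexp : -(r ^ 2 / (4 * M * c ^ 2))
      ≤ -((10 : ℝ) ^ (-12 : ℤ) * ε ^ 3 * ((M : ℝ) / (2 : ℝ) ^ I)) := by
    rw [neg_le_neg_iff, hr2, hc2]
    calc (10 : ℝ) ^ (-12 : ℤ) * ε ^ 3 * ((M : ℝ) / (2 : ℝ) ^ I)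
        ≤ 1 / 128 * ε ^ 2 * ((M : ℝ) / (2 : ℝ) ^ I) := by
          gcongr
          norm_num
      _ = ε ^ 2 * M / (16 * (8 * 2 ^ I)) := by field_simp; norm_num
      _ ≤ ε ^ 2 * M / (16 * (D * C)) := by gcongr
      _ = ε ^ 2 * M ^ 2 / D / (4 * M * (4 * C)) := by field_simp; norm_num
  calc _ ≤ P.real {ω | r ≤ ‖∑ m, Y m ω‖} := measureReal_mono hsub
    _ ≤ _ := hmain
    _ ≤ 1 * Real.exp (-((10 : ℝ) ^ (-12 : ℤ) * ε ^ 3 * ((M : ℝ) / (2 : ℝ) ^ I))) := by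
        rw [one_mul, Real.exp_le_exp]
        exact (chernoff_exponent hM hc0 h4 hr0).trans hexp
    _ ≤ _ := by gcongr; linarith
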